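/- Let $k$ be a commutative ring; all Lie algebras are Lie algebras over $k$. A \emph{crossed module} is a Lie algebra homomorphism $\delta:\mathfrak m\to\mathfrak n$ together with an action of $\mathfrak n$ on $\mathfrak m$ by derivations, i.e. a Lie algebra map $\mathfrak n\to\mathrm{Der}(\mathfrak m)$, $x\mapsto(y\mapsto{}^xy)$, such that $\delta({}^{x}y)=[x,\delta(y)]$ and ${}^{\delta(y)}y'=[y,y']$ for all $x\in\mathfrak n$, $y,y'\in\mathfrak m$. A \emph{homomorphism of crossed modules} $(\mathfrak m\xrightarrow{\delta}\mathfrak n)\to(\mathfrak m'\xrightarrow{\delta'}\mathfrak n')$ is a pair of Lie algebra maps $\lambda:\mathfrak m\to\mathfrak m'$, $\mu:\mathfrak n\to\mathfrak n'$ with $\mu\delta=\delta'\lambda$ and $\lambda({}^xy)={}^{\mu(x)}\lambda(y)$. A \emph{crossed extension} of a Lie algebra $\mathfrak q$ by an abelian Lie algebra $M$ is an exact sequence of Lie algebras $$0\to M\xrightarrow{\iota}\mathfrak m\xrightarrow{\delta}\mathfrak n\xrightarrow{\pi}\mathfrak q\to0$$ in which $\delta$ is a crossed module; it induces an action of $\mathfrak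 q$ on $M$, given by $\iota(\pi(x)\cdot a)={}^{x}\iota(a)$ for $x\in\mathfrak n$, $a\in M$. \emph{Equivalence} of crossed extensions of $\mathfrak q$ by $M$ is the equivalence relation generated by: $\underline e\sim\underline e'$ if there is a homomorphism of crossed modules $(\lambda,\mu)$ from $\underline e$ to $\underline e'$ with $\lambda\iota=\iota'$ and $\pi'\mu=\pi$. Given an action of $\mathfrak q$ on $M$, the \emph{zero crossed extension} is $0\to M=M\xrightarrow{0}\mathfrak q=\mathfrak q\to0$, where $M\xrightarrow{0}\mathfrak q$ is a crossed module through this action. \textbf{Lemma.} Let $$\underline e:\ 0\to M\to\mathfrak m\xrightarrow{\delta}\mathfrak g\xrightarrow{\pi}\mathfrak q\to0$$ be a crossed extension. Then $\underline e$ is equivalent to the zero crossed extension of $\mathfrak q$ by $M$ (for the action of $\mathfrak q$ on $M$ induced by $\underline e$) if and only if there exist a short exact sequence of Lie algebras $$0\to\mathfrak m\xrightarrow{i}\mathfrak e\xrightarrow{p}\mathfrak q\to0$$ and a Lie algebra homomorphism $h:\mathfrak e\to\mathfrak g$ such that $h\circ i=\delta$, $\pi\circ h=p$, and $(\mathbb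 1_{\mathfrak m},h)$ is a homomorphism of crossed modules from $\mathfrak m\xrightarrow{i}\mathfrak e$ to $\mathfrak m\xrightarrow{\delta}\mathfrak g$, where $\mathfrak e$ acts on its ideal $\mathfrak m\cong i(\mathfrak m)$ by the bracket, i.e. $i({}^xy)=[x,i(y)]$. -/

import Mathlib

universe u v

/-- A crossed module of Lie algebras over `R`: a Lie algebra homomorphism `bdry : m → n`, together
with an action of `n` on `m` by derivations (a Lie algebra map `n → Der(m)`), which is equivariant
for the adjoint action on `n` and satisfies the Peiffer identity. -/
structure LieCrossedModule (R : Type*) (m n : Type*) [CommRing R]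
    [LieRing m] [LieAlgebra R m] [LieRing n] [LieAlgebra R n] where
  /-- The boundary map `δ`. -/
  bdry : m →ₗ⁅R⁆ n
  /-- The action of `n` on `m`. -/
  act : n →ₗ⁅R⁆ LieDerivation R m m
  bdry_act : ∀ (x : n) (y : m), bdry (act x y) = ⁅x, bdry y⁆
  act_bdry : ∀ y y' : m, act (bdry y) y' = ⁅y, y'⁆

/-- The pair of Lie algebra maps `(f, g)` is a homomorphism of crossed modules from `X` to `X'`. -/
structure LieCrossedModule.IsHom {R m n m' n' : Type*} [CommRing R]
    [LieRing m] [LieAlgebra R m] [LieRing n] [LieAlgebra R n]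
    [LieRing m'] [LieAlgebra R m'] [LieRing n'] [LieAlgebra R n']
    (X : LieCrossedModule R m n) (X' : LieCrossedModule R m' n')
    (f : m →ₗ⁅R⁆ m') (g : n →ₗ⁅R⁆ n') : Prop where
  comm : ∀ y : m, g (X.bdry y) = X'.bdry (f y)
  map_act : ∀ (x : n) (y : m), f (X.act x y) = X'.act (g x) (f y)

/-- A crossed extension `0 → M → m → n → q → 0` of the Lie algebra `q` by the abelian Lie
algebra `M`: an exact sequence of Lie algebras whose middle map is a crossed module. -/
structure LieCrossedExtension (R : Type u) (q M : Type v) [CommRing R]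
    [LieRing q] [LieAlgebra R q] [LieRing M] [LieAlgebra R M] [IsLieAbelian M] where
  /-- The source of the crossed module. -/
  m : Type v
  /-- The target of the crossed module. -/
  n : Type v
  [instLieRing_m : LieRing m]
  [instLieAlgebra_m : LieAlgebra R m]
  [instLieRing_n : LieRing n]
  [instLieAlgebra_n : LieAlgebra R n]
  /-- The crossed module `m → n`. -/
  cm : LieCrossedModule R m n
  /-- The map `M → m`. -/
  incl : M →ₗ⁅R⁆ m
  /-- The map `n → q`. -/
  proj : n →ₗ⁅R⁆ q
  incl_injective : Function.Injective incl
  exact_incl_bdry : Function.Exact incl cm.bdry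
  exact_bdry_proj : Function.Exact cm.bdry proj
  proj_surjective : Function.Surjective proj

namespace LieCrossedExtension

variable {R : Type u} {q M : Type v} [CommRing R]
  [LieRing q] [LieAlgebra R q] [LieRing M] [LieAlgebra R M] [IsLieAbelian M]

instance (E : LieCrossedExtension R q M) : LieRing E.m := E.instLieRing_m
instance (E : LieCrossedExtension R q M) : LieAlgebra R E.m := E.instLieAlgebra_m
instance (E : LieCrossedExtension R q M) : LieRing E.n := E.instLieRing_n
instance (E : LieCrossedExtension R q M) : LieAlgebra R E.n := E.instLieAlgebra_n

/-- There is a morphism of crossed extensions `E → E'` which is the identity on `M` and on `q`. -/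
def HasMorphism (E E' : LieCrossedExtension R q M) : Prop :=
  ∃ (f : E.m →ₗ⁅R⁆ E'.m) (g : E.n →ₗ⁅R⁆ E'.n),
    E.cm.IsHom E'.cm f g ∧ (∀ a, f (E.incl a) = E'.incl a) ∧ (∀ x, E'.proj (g x) = E.proj x)

/-- Equivalence of crossed extensions: the equivalence relation generated by `HasMorphism`. -/
def Equivalent (E E' : LieCrossedExtension R q M) : Prop :=
  Relation.EqvGen HasMorphism E E'

section InducedAction

variable (E : LieCrossedExtension R q M)

theorem exists_incl_eq_act (x : E.n) (a : M) : ∃ b : M, E.incl b = E.cm.act x (E.incl a) := by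
  have h : E.cm.bdry (E.cm.act x (E.incl a)) = 0 := by
    rw [E.cm.bdry_act, E.exact_incl_bdry.apply_apply_eq_zero, lie_zero]
  exact (E.exact_incl_bdry _).1 h

theorem act_incl_eq_of_proj_eq {x y : E.n} (h : E.proj x = E.proj y) (a : M) :
    E.cm.act x (E.incl a) = E.cm.act y (E.incl a) := by
  obtain ⟨z, hz⟩ := (E.exact_bdry_proj (x - y)).1 (by rw [map_sub, h, sub_self])
  have h0 : E.cm.act (x - y) (E.incl a) = 0 := by
    rw [← hz, E.cm.act_bdry, ← lie_skew, ← E.cm.act_bdry,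
      E.exact_incl_bdry.apply_apply_eq_zero, map_zero, LieDerivation.zero_apply, neg_zero]
  rw [map_sub, LieDerivation.sub_apply] at h0
  exact sub_eq_zero.1 h0

/-- The underlying function of the induced action of `q` on `M`. -/
noncomputable def inducedFun (t : q) (a : M) : M :=
  (E.exists_incl_eq_act (Function.surjInv E.proj_surjective t) a).choose

theorem incl_inducedFun (x : E.n) (a : M) :
    E.incl (E.inducedFun (E.proj x) a) = E.cm.act x (E.incl a) :=
  (E.exists_incl_eq_act (Function.surjInv E.proj_surjective (E.proj x)) a).choose_spec.trans
    (E.act_incl_eq_of_proj_eq (Function.surjInv_eq E.proj_surjective _) a)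

/-- The action of `q` on `M` induced by the crossed module: `t` acts on `a` by letting any lift
of `t` to `n` act on the image of `a` in `m`. -/
noncomputable def inducedAction : q →ₗ⁅R⁆ LieDerivation R M M where
  toFun t :=
    { toFun := E.inducedFun t
      map_add' := fun a b => by
        obtain ⟨x, rfl⟩ := E.proj_surjective t
        apply E.incl_injective
        simp only [map_add, incl_inducedFun]
      map_smul' := fun c a => by
        obtain ⟨x, rfl⟩ := E.proj_surjective t
        apply E.incl_injective
        simp only [map_smul, incl_inducedFun, RingHom.id_apply]
      leibniz' := fun a b => by
        obtain ⟨x, rfl⟩ := E.proj_surjective t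
        apply E.incl_injective
        simp [incl_inducedFun] }
  map_add' s t := by
    obtain ⟨x, rfl⟩ := E.proj_surjective s
    obtain ⟨y, rfl⟩ := E.proj_surjective t
    ext a
    apply E.incl_injective
    change E.incl (E.inducedFun (E.proj x + E.proj y) a) =
      E.incl (E.inducedFun (E.proj x) a + E.inducedFun (E.proj y) a)
    rw [← map_add E.proj, map_add E.incl]
    rw [incl_inducedFun, incl_inducedFun, incl_inducedFun, map_add, LieDerivation.add_apply]
  map_smul' c t := by
    obtain ⟨x, rfl⟩ := E.proj_surjective t
    ext a
    apply E.incl_injective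
    change E.incl (E.inducedFun (c • E.proj x) a) = E.incl (c • E.inducedFun (E.proj x) a)
    rw [← map_smul E.proj, map_smul E.incl]
    rw [incl_inducedFun, incl_inducedFun, map_smul, LieDerivation.smul_apply]
  map_lie' {s t} := by
    obtain ⟨x, rfl⟩ := E.proj_surjective s
    obtain ⟨y, rfl⟩ := E.proj_surjective t
    ext a
    apply E.incl_injective
    rw [LieDerivation.commutator_apply]
    change E.incl (E.inducedFun ⁅E.proj x, E.proj y⁆ a) =
      E.incl (E.inducedFun (E.proj x) (E.inducedFun (E.proj y) a) -
        E.inducedFun (E.proj y) (E.inducedFun (E.proj x) a))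
    rw [← LieHom.map_lie, map_sub E.incl]
    rw [incl_inducedFun, incl_inducedFun, incl_inducedFun, incl_inducedFun, incl_inducedFun,
      LieHom.map_lie, LieDerivation.commutator_apply]

theorem incl_inducedAction (x : E.n) (a : M) :
    E.incl (E.inducedAction (E.proj x) a) = E.cm.act x (E.incl a) :=
  E.incl_inducedFun x a

end InducedAction

/-- The zero crossed extension `0 → M = M → q = q → 0` (with middle map `0`), for an abelian Lie
algebra `M` on which `q` acts through `φ`. For abelian `M`, every linear endomorphism is a
derivation, so that `φ` is the same thing as a `q`-module structure on `M`. -/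
def zero (φ : q →ₗ⁅R⁆ LieDerivation R M M) : LieCrossedExtension R q M where
  m := M
  n := q
  cm :=
    { bdry := 0
      act := φ
      bdry_act := fun x y => by simp
      act_bdry := fun y y' => by rw [trivial_lie_zero]; simp }
  incl := LieHom.id
  proj := LieHom.id
  incl_injective := fun _ _ h => h
  exact_incl_bdry := fun y => by simp
  exact_bdry_proj := fun x => by simp
  proj_surjective := fun x => ⟨x, rfl⟩

end LieCrossedExtension

namespace LieAlgebra.Extension

variable {R : Type*} {m q : Type*} [CommRing R]
  [LieRing m] [LieAlgebra R m] [LieRing q] [LieAlgebra R q]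

theorem exists_incl_eq_lie (E : LieAlgebra.Extension R m q) (x : E.L) (y : m) :
    ∃ z : m, E.incl z = ⁅x, E.incl y⁆ := by
  have h : E.proj ⁅x, E.incl y⁆ = 0 := by
    rw [LieHom.map_lie, E.proj_incl, lie_zero]
  exact ((E.incl.range_eq_ker_iff E.proj).1 E.IsExtension.exact _).1 h

/-- The underlying function of the adjoint action of `E.L` on its ideal `m`. -/
noncomputable def adjFun (E : LieAlgebra.Extension R m q) (x : E.L) (y : m) : m :=
  (E.exists_incl_eq_lie x y).choose

theorem incl_adjFun (E : LieAlgebra.Extension R m q) (x : E.L) (y : m) :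
    E.incl (E.adjFun x y) = ⁅x, E.incl y⁆ :=
  (E.exists_incl_eq_lie x y).choose_spec

/-- The crossed module `m → E.L` attached to a short exact sequence `0 → m → E.L → q → 0` of Lie
algebras: `m` is identified with an ideal of `E.L`, on which `E.L` acts by the bracket. -/
noncomputable def crossedModule (E : LieAlgebra.Extension R m q) : LieCrossedModule R m E.L where
  bdry := E.incl
  act :=
    { toFun := fun x =>
        { toFun := E.adjFun x
          map_add' := fun a b => E.incl_injective <| by
            simp only [incl_adjFun, map_add, lie_add]
          map_smul' := fun c a => E.incl_injective <| by
            simp only [incl_adjFun, map_smul, lie_smul, RingHom.id_apply]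
          leibniz' := fun a b => E.incl_injective <| by
            change E.incl (E.adjFun x ⁅a, b⁆) = E.incl (⁅a, E.adjFun x b⁆ - ⁅b, E.adjFun x a⁆)
            simp only [incl_adjFun, map_sub, LieHom.map_lie]
            rw [leibniz_lie x, ← lie_skew (E.incl b) ⁅x, E.incl a⁆]
            abel }
      map_add' := fun s t => by
        ext a
        apply E.incl_injective
        change E.incl (E.adjFun (s + t) a) = E.incl (E.adjFun s a + E.adjFun t a)
        simp only [incl_adjFun, map_add, add_lie]
      map_smul' := fun c t => by
        ext a
        apply E.incl_injective
        change E.incl (E.adjFun (c • t) a) = E.incl (c • E.adjFun t a)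
        simp only [incl_adjFun, map_smul, smul_lie]
      map_lie' := fun {s t} => by
        ext a
        apply E.incl_injective
        rw [LieDerivation.commutator_apply]
        change E.incl (E.adjFun ⁅s, t⁆ a) =
          E.incl (E.adjFun s (E.adjFun t a) - E.adjFun t (E.adjFun s a))
        simp only [incl_adjFun, map_sub, lie_lie] }
  bdry_act := fun x y => E.incl_adjFun x y
  act_bdry := fun y y' => E.incl_injective <| by
    change E.incl (E.adjFun (E.incl y) y') = _
    rw [incl_adjFun, LieHom.map_lie]

end LieAlgebra.Extension

/-!
A crossed extension `E` lifts to an extension when `E.cm` is the image of a short exact sequence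
`0 → m → e → q → 0` under a map `h : e → n` as in the theorem. The key point is that this property
is invariant under morphisms of crossed extensions that are the identity on `M` and `q`, in both
directions.

* Backwards along `(f, g) : E → E'`, one takes the fibre product `e' ×_{n'} n`. The kernel of its
  map to `q` is exactly `m`, because `f` restricts to the identity on `ker δ = M = ker δ'`
  (`LiftsToExtension.of_hasMorphism`).
* Forwards along `(f, g) : E → E'`, one takes the pushout of `m → e` along `f : m → m'`, which is
  the quotient of the semidirect sum `m' ⋊ e` by the ideal `{(-f y, i y) | y ∈ m}`
  (`Extension.pushout`, `LiftsToExtension.map`).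

The zero crossed extension lifts to the semidirect sum `M ⋊ q`, so everything equivalent to it
lifts. Conversely, if `E` lifts to `e`, then `0 → M → M × m → e → q → 0` is a crossed extension
(`LieCrossedExtension.ofExtension`) which maps to the zero crossed extension by the projection
`M × m → M`, and to `E` by `(a, y) ↦ ι a + y`.
-/

/-! ### Fibre products and pushouts of extensions -/

/-- The fibre product of two Lie algebra homomorphisms. -/
def LieHom.fibreProduct {R A B C : Type*} [CommRing R] [LieRing A] [LieAlgebra R A] [LieRing B]
    [LieAlgebra R B] [LieRing C] [LieAlgebra R C] (h : A →ₗ⁅R⁆ C) (g : B →ₗ⁅R⁆ C) :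
    LieSubalgebra R (A × B) where
  carrier := {z | h z.1 = g z.2}
  zero_mem' := by simp
  add_mem' := by
    intro a b (ha : _ = _) (hb : _ = _)
    simp [ha, hb]
  smul_mem' := by
    intro c a (ha : _ = _)
    simp [ha]
  lie_mem' := by
    intro a b (ha : _ = _) (hb : _ = _)
    simp [ha, hb]

namespace LieAlgebra.Extension

section Pushout

variable {R m q m' n : Type*} [CommRing R]
  [LieRing m] [LieAlgebra R m] [LieRing q] [LieAlgebra R q]
  [LieRing m'] [LieAlgebra R m'] [LieRing n] [LieAlgebra R n]
  (S : LieAlgebra.Extension R m q) (f : m →ₗ⁅R⁆ m') (φ : S.L →ₗ⁅R⁆ LieDerivation R m' m')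

theorem incl_crossedModule_act (x : S.L) (y : m) :
    S.incl (S.crossedModule.act x y) = ⁅x, S.incl y⁆ :=
  S.incl_adjFun x y

theorem exact_incl_proj : Function.Exact S.incl S.proj :=
  (S.incl.range_eq_ker_iff S.proj).1 S.IsExtension.exact

/-- The antidiagonal copy `{(-f y, i y) | y ∈ m}` of `m` in the semidirect sum `m' ⋊ e`. It is an
ideal as soon as `f` is equivariant and `m` acts on `m'` through `f` and the bracket. -/
def pushoutIdeal (hφ : ∀ y b, φ (S.incl y) b = ⁅f y, b⁆)
    (hf : ∀ x y, f (S.crossedModule.act x y) = φ x (f y)) :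
    LieIdeal R (m' ⋊⁅φ⁆ S.L) where
  carrier := {z | ∃ y : m, z = ⟨-f y, S.incl y⟩}
  zero_mem' := ⟨0, by simp⟩
  add_mem' := by
    rintro _ _ ⟨y, rfl⟩ ⟨z, rfl⟩
    exact ⟨y + z, by simp [add_comm]⟩
  smul_mem' := by
    rintro c _ ⟨y, rfl⟩
    exact ⟨c • y, by simp⟩
  lie_mem := by
    rintro ⟨b, x⟩ _ ⟨y, rfl⟩
    refine ⟨S.crossedModule.act x y, ?_⟩
    rw [SemiDirectSum.lie_eq_mk, incl_crossedModule_act, hf]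
    simp only [lie_neg, map_neg, hφ, ← lie_skew (f y) b]
    congr 1
    abel

variable {S f φ} (hφ : ∀ y b, φ (S.incl y) b = ⁅f y, b⁆)
  (hf : ∀ x y, f (S.crossedModule.act x y) = φ x (f y))

/-- The map out of the pushout `(m' ⋊ e) / m` induced by `k : m' → n` and `h : e → n` which agree
on `m` and intertwine the action of `e` on `m'` with the bracket of `n`. -/
def pushoutDesc (k : m' →ₗ⁅R⁆ n) (h : S.L →ₗ⁅R⁆ n) (hk : ∀ y, k (f y) = h (S.incl y))
    (hact : ∀ x b, k (φ x b) = ⁅h x, k b⁆) :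
    (m' ⋊⁅φ⁆ S.L) ⧸ pushoutIdeal S f φ hφ hf →ₗ⁅R⁆ n where
  toLinearMap := (pushoutIdeal S f φ hφ hf).toSubmodule.liftQ
    { toFun := fun z => k z.left + h z.right
      map_add' := fun z w => by
        simp only [SemiDirectSum.add_eq_mk, map_add]
        abel
      map_smul' := fun c z => by simp }
    (by
      rintro _ ⟨y, rfl⟩
      simp [hk])
  map_lie' := by
    intro z w
    induction z using Submodule.Quotient.induction_on with | _ z
    induction w using Submodule.Quotient.induction_on with | _ w
    change k ⁅z, w⁆.left + h ⁅z, w⁆.right =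
      ⁅k z.left + h z.right, k w.left + h w.right⁆
    simp only [SemiDirectSum.lie_eq_mk, map_add, map_sub, LieHom.map_lie, hact, lie_add, add_lie,
      ← lie_skew (h w.right) (k z.left)]
    abel

/-- The pushout of the extension `0 → m → e → q → 0` along `f : m → m'`, for an action of `e` on
`m'` that makes `(f, 1)` a homomorphism of crossed modules: its middle term is the quotient of the
semidirect sum `m' ⋊ e` by the antidiagonal copy of `m`. -/
def pushout : LieAlgebra.Extension R m' q where
  L := (m' ⋊⁅φ⁆ S.L) ⧸ pushoutIdeal S f φ hφ hf
  instLieRing := inferInstance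
  instLieAlgebra := inferInstance
  incl :=
    { toFun := fun b => LieSubmodule.Quotient.mk (⟨b, 0⟩ : m' ⋊⁅φ⁆ S.L)
      map_add' := fun a b => by
        rw [← Submodule.Quotient.mk_add]
        simp
      map_smul' := fun c a => by
        rw [RingHom.id_apply, ← Submodule.Quotient.mk_smul]
        simp
      map_lie' := fun {a b} => by
        rw [← LieSubmodule.Quotient.mk_bracket]
        simp }
  proj := pushoutDesc hφ hf 0 S.proj (by simp) (by simp)
  IsExtension :=
    { ker_eq_bot := by
        rw [LieHom.ker_eq_bot, injective_iff_map_eq_zero]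
        intro b hb
        obtain ⟨y, hy⟩ := (LieSubmodule.Quotient.mk_eq_zero' (N := pushoutIdeal S f φ hφ hf)).1 hb
        rw [SemiDirectSum.mk.injEq] at hy
        rw [hy.1, S.incl_injective (hy.2.symm.trans (map_zero S.incl).symm), map_zero, neg_zero]
      range_eq_top := by
        rw [LieHom.range_eq_top]
        intro t
        obtain ⟨x, rfl⟩ := S.proj_surjective t
        exact ⟨LieSubmodule.Quotient.mk (⟨0, x⟩ : m' ⋊⁅φ⁆ S.L), zero_add _⟩
      exact := by
        rw [LieHom.range_eq_ker_iff]
        intro z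
        induction z using Submodule.Quotient.induction_on with | _ z
        obtain ⟨b, x⟩ := z
        constructor
        · intro hz
          replace hz : 0 + S.proj x = 0 := hz
          obtain ⟨y, rfl⟩ := (S.exact_incl_proj x).1 ((zero_add _).symm.trans hz)
          -- `(b, i y)` and `(b + f y, 0)` differ by `(-f y, i y)`.
          refine ⟨b + f y, (Submodule.Quotient.eq _).2 ⟨-y, ?_⟩⟩
          simp
        · rintro ⟨c, hc⟩
          rw [← hc]
          exact (zero_add _).trans (map_zero S.proj) }

end Pushout

end LieAlgebra.Extension

/-! ### Lifting the crossed module to an extension -/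

namespace LieCrossedExtension

variable {R : Type u} {q M : Type v} [CommRing R]
  [LieRing q] [LieAlgebra R q] [LieRing M] [LieAlgebra R M] [IsLieAbelian M]

/-- The crossed module of `E` comes from a short exact sequence `0 → m → e → q → 0` along a
homomorphism `h : e → n` under `m` and over `q`, through which `e` acts on `m` by the bracket. -/
def LiftsToExtension (E : LieCrossedExtension R q M) : Prop :=
  ∃ (S : LieAlgebra.Extension.{u, v, v, v} R E.m q) (h : S.L →ₗ⁅R⁆ E.n),
    (∀ y : E.m, h (S.incl y) = E.cm.bdry y) ∧
    (∀ x : S.L, E.proj (h x) = S.proj x) ∧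
    ∀ (x : S.L) (y : E.m), S.incl (E.cm.act (h x) y) = ⁅x, S.incl y⁆

theorem liftsToExtension_iff (E : LieCrossedExtension R q M) :
    E.LiftsToExtension ↔
      ∃ (S : LieAlgebra.Extension.{u, v, v, v} R E.m q) (h : S.L →ₗ⁅R⁆ E.n),
        (∀ y : E.m, h (S.incl y) = E.cm.bdry y) ∧
        (∀ x : S.L, E.proj (h x) = S.proj x) ∧
        LieCrossedModule.IsHom S.crossedModule E.cm (LieHom.id : E.m →ₗ⁅R⁆ E.m) h := by
  refine exists_congr fun S => exists_congr fun h => and_congr_right fun h1 =>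
    and_congr_right fun _ => ⟨fun h3 => ⟨h1, fun x y => ?_⟩, fun h3 x y => ?_⟩
  · exact S.incl_injective ((S.incl_crossedModule_act x y).trans (h3 x y).symm)
  · rw [← S.incl_crossedModule_act]
    exact congrArg S.incl (h3.map_act x y).symm

theorem zero_liftsToExtension (φ : q →ₗ⁅R⁆ LieDerivation R M M) :
    (zero φ).LiftsToExtension := by
  refine ⟨(inferInstance : LieAlgebra.IsExtension (LieAlgebra.SemiDirectSum.inl φ)
    (LieAlgebra.SemiDirectSum.projr φ)).extension, LieAlgebra.SemiDirectSum.projr φ,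
    fun _ => rfl, fun _ => rfl, fun (x : M ⋊⁅φ⁆ q) (y : M) => ?_⟩
  change (⟨φ x.right y, 0⟩ : M ⋊⁅φ⁆ q) = ⁅x, (⟨y, 0⟩ : M ⋊⁅φ⁆ q)⁆
  simp [LieAlgebra.SemiDirectSum.lie_eq_mk, trivial_lie_zero]

/-- Lifts push forward along morphisms, by the pushout of extensions. -/
theorem LiftsToExtension.map {E E' : LieCrossedExtension R q M} (hE : E.LiftsToExtension)
    (hEE' : E.HasMorphism E') : E'.LiftsToExtension := by
  obtain ⟨S, h, hincl, hproj, hact⟩ := hE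
  obtain ⟨f, g, hfg, -, hq⟩ := hEE'
  have hφ : ∀ y b, (E'.cm.act.comp (g.comp h)) (S.incl y) b = ⁅f y, b⁆ := fun y b => by
    simp only [LieHom.comp_apply, hincl, hfg.comm, E'.cm.act_bdry]
  have hf : ∀ x y, f (S.crossedModule.act x y) = (E'.cm.act.comp (g.comp h)) x (f y) := by
    intro x y
    have : S.crossedModule.act x y = E.cm.act (h x) y :=
      S.incl_injective ((S.incl_crossedModule_act x y).trans (hact x y).symm)
    rw [this, hfg.map_act]
    rfl
  refine ⟨S.pushout hφ hf, LieAlgebra.Extension.pushoutDesc hφ hf E'.cm.bdry (g.comp h)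
    (fun y => ?_) (fun x b => E'.cm.bdry_act _ _), fun b => ?_, fun z => ?_, fun z b => ?_⟩
  · rw [LieHom.comp_apply, hincl, hfg.comm]
  · change E'.cm.bdry b + (g.comp h) 0 = E'.cm.bdry b
    rw [map_zero, add_zero]
  · induction z using Submodule.Quotient.induction_on with | _ z
    change E'.proj (E'.cm.bdry z.left + g (h z.right)) = 0 + S.proj z.right
    rw [map_add, E'.exact_bdry_proj.apply_apply_eq_zero, hq, hproj]
  · induction z using Submodule.Quotient.induction_on with | _ z
    change LieSubmodule.Quotient.mk (⟨E'.cm.act (E'.cm.bdry z.left + g (h z.right)) b, 0⟩ :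
        E'.m ⋊⁅E'.cm.act.comp (g.comp h)⁆ S.L) =
      LieSubmodule.Quotient.mk ⁅z, (⟨b, 0⟩ : E'.m ⋊⁅E'.cm.act.comp (g.comp h)⁆ S.L)⁆
    congr 1
    simp [LieAlgebra.SemiDirectSum.lie_eq_mk, E'.cm.act_bdry]

/-- Lifts pull back along morphisms, by the fibre product. -/
theorem LiftsToExtension.of_hasMorphism {E E' : LieCrossedExtension R q M}
    (hE' : E'.LiftsToExtension) (hEE' : E.HasMorphism E') : E.LiftsToExtension := by
  obtain ⟨S, h, hincl, hproj, hact⟩ := hE'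
  obtain ⟨f, g, hfg, hM, hq⟩ := hEE'
  let P := LieHom.fibreProduct h g
  let i : E.m →ₗ⁅R⁆ P :=
    { toFun := fun y => ⟨(S.incl (f y), E.cm.bdry y), (hincl _).trans (hfg.comm y).symm⟩
      map_add' := fun a b => Subtype.ext (by simp)
      map_smul' := fun c a => Subtype.ext (by simp)
      map_lie' := fun {a b} => Subtype.ext (by simp) }
  let p : P →ₗ⁅R⁆ q := (E.proj.comp (LieHom.snd R S.L E.n)).comp P.incl
  have hi : Function.Injective i := by
    rw [injective_iff_map_eq_zero]
    intro y hy
    have hy' : (S.incl (f y), E.cm.bdry y) = 0 := congrArg Subtype.val hy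
    rw [Prod.mk_eq_zero] at hy'
    obtain ⟨a, rfl⟩ := (E.exact_incl_bdry y).1 hy'.2
    have ha : E'.incl a = 0 := by
      rw [← hM]
      exact S.incl_injective (hy'.1.trans (map_zero _).symm)
    rw [E'.incl_injective (ha.trans (map_zero _).symm), map_zero]
  have hp : Function.Surjective p := by
    intro t
    obtain ⟨x, rfl⟩ := E.proj_surjective t
    obtain ⟨x', hx'⟩ := S.proj_surjective (E.proj x)
    -- `h x'` and `g x` have the same image in `q`; correcting `x'` by an element of `m'` makes
    -- them equal.
    obtain ⟨z, hz⟩ := (E'.exact_bdry_proj (g x - h x')).1 (by rw [map_sub, hq, hproj, hx', sub_self])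
    refine ⟨⟨(x' + S.incl z, x), ?_⟩, rfl⟩
    change h (x' + S.incl z) = g x
    rw [map_add, hincl, hz, add_sub_cancel]
  have hip : Function.Exact i p := by
    rintro ⟨⟨x', x⟩, hx : h x' = g x⟩
    constructor
    · intro hpx
      obtain ⟨y, rfl⟩ := (E.exact_bdry_proj x).1 hpx
      obtain ⟨z, rfl⟩ := (S.exact_incl_proj x').1 (by
        rw [← hproj, hx, hq, E.exact_bdry_proj.apply_apply_eq_zero])
      -- `z` and `f y` have the same boundary, so they differ by some `a : M`, on which `f` is `id`.
      rw [hincl, hfg.comm] at hx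
      obtain ⟨a, ha⟩ := (E'.exact_incl_bdry (z - f y)).1 (by rw [map_sub, hx, sub_self])
      refine ⟨y + E.incl a, Subtype.ext (Prod.ext ?_ ?_)⟩
      · change S.incl (f (y + E.incl a)) = S.incl z
        rw [map_add f, hM, ha, add_sub_cancel]
      · change E.cm.bdry (y + E.incl a) = E.cm.bdry y
        rw [map_add, E.exact_incl_bdry.apply_apply_eq_zero, add_zero]
    · rintro ⟨y, hy⟩
      rw [← hy]
      exact E.exact_bdry_proj.apply_apply_eq_zero y
  have hext : LieAlgebra.IsExtension i p :=
    ⟨(LieHom.ker_eq_bot _).2 hi, (LieHom.range_eq_top _).2 hp, (i.range_eq_ker_iff p).2 hip⟩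
  refine ⟨hext.extension, (LieHom.snd R S.L E.n).comp P.incl, fun _ => rfl, fun _ => rfl, ?_⟩
  rintro ⟨⟨x', x⟩, hx : h x' = g x⟩ y
  refine Subtype.ext (Prod.ext ?_ ?_)
  · change S.incl (f (E.cm.act x y)) = ⁅x', S.incl (f y)⁆
    rw [hfg.map_act, ← hx, hact]
  · exact E.cm.bdry_act x y

theorem Equivalent.liftsToExtension_iff {E E' : LieCrossedExtension R q M}
    (h : E.Equivalent E') : E.LiftsToExtension ↔ E'.LiftsToExtension := by
  induction h with
  | rel _ _ h => exact ⟨fun hE => hE.map h, fun hE' => hE'.of_hasMorphism h⟩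
  | refl _ => exact Iff.rfl
  | symm _ _ _ ih => exact ih.symm
  | trans _ _ _ _ _ ih₁ ih₂ => exact ih₁.trans ih₂

/-! ### From an extension to an equivalence with the zero crossed extension -/

section OfExtension

variable {m : Type v} [LieRing m] [LieAlgebra R m]

/-- The crossed extension `0 → M → M × m → e → q → 0` attached to an extension
`0 → m → e → q → 0` and an action of `q` on `M`: the algebra `e` acts on `M` through `q`, and on
`m` by the bracket. -/
noncomputable def ofExtension (S : LieAlgebra.Extension.{u, v, v, v} R m q)
    (φ : q →ₗ⁅R⁆ LieDerivation R M M) : LieCrossedExtension R q M where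
  m := M × m
  n := S.L
  cm :=
    { bdry := S.incl.comp (LieHom.snd R M m)
      act :=
        { toFun := fun x =>
            { toLinearMap := LinearMap.prodMap (φ (S.proj x) : M →ₗ[R] M)
                (S.crossedModule.act x : m →ₗ[R] m)
              leibniz' := fun a b => by
                ext <;> simp }
          map_add' := fun x y => by
            ext a <;> simp
          map_smul' := fun c x => by
            ext a <;> simp
          map_lie' := fun {x y} => by
            ext a <;> simp <;> rfl }
      bdry_act := fun x y => S.incl_crossedModule_act x y.2
      act_bdry := fun y y' => by
        refine Prod.ext ?_ (S.crossedModule.act_bdry y.2 y'.2)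
        change φ (S.proj (S.incl y.2)) y'.1 = ⁅y.1, y'.1⁆
        rw [S.proj_incl, map_zero, LieDerivation.zero_apply, trivial_lie_zero] }
  incl := LieHom.inl R M m
  proj := S.proj
  incl_injective := LieHom.inl_injective
  exact_incl_bdry := fun y => by
    constructor
    · intro hy
      exact ⟨y.1, Prod.ext rfl (S.incl_injective (hy.trans (map_zero _).symm)).symm⟩
    · rintro ⟨a, rfl⟩
      exact map_zero S.incl
  exact_bdry_proj := fun x => by
    refine (S.exact_incl_proj x).trans ⟨?_, ?_⟩
    · rintro ⟨y, rfl⟩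
      exact ⟨(0, y), rfl⟩
    · rintro ⟨y, rfl⟩
      exact ⟨y.2, rfl⟩
  proj_surjective := S.proj_surjective

theorem ofExtension_hasMorphism_zero (S : LieAlgebra.Extension.{u, v, v, v} R m q)
    (φ : q →ₗ⁅R⁆ LieDerivation R M M) : (ofExtension S φ).HasMorphism (zero φ) :=
  ⟨LieHom.fst R M m, S.proj, ⟨fun y => S.proj_incl y.2, fun _ _ => rfl⟩, fun _ => rfl,
    fun _ => rfl⟩

end OfExtension

theorem incl_lie_eq_zero (E : LieCrossedExtension R q M) (a : M) (y : E.m) :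
    ⁅E.incl a, y⁆ = 0 := by
  rw [← E.cm.act_bdry, E.exact_incl_bdry.apply_apply_eq_zero, map_zero, LieDerivation.zero_apply]

/-- The Lie algebra homomorphism `M × m → m`, `(a, y) ↦ ι a + y`; it respects brackets because
`ι M` is central in `m`. -/
def inclAdd (E : LieCrossedExtension R q M) : M × E.m →ₗ⁅R⁆ E.m where
  toLinearMap := LinearMap.coprod (E.incl : M →ₗ[R] E.m) LinearMap.id
  map_lie' := fun {a b} => by
    have h : ⁅a.2, E.incl b.1⁆ = 0 := by rw [← lie_skew, E.incl_lie_eq_zero, neg_zero]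
    change E.incl ⁅a.1, b.1⁆ + ⁅a.2, b.2⁆ = ⁅E.incl a.1 + a.2, E.incl b.1 + b.2⁆
    rw [LieHom.map_lie, add_lie, lie_add, lie_add, h, E.incl_lie_eq_zero a.1 b.2, add_zero,
      zero_add]

theorem LiftsToExtension.equivalent_zero {E : LieCrossedExtension R q M}
    (hE : E.LiftsToExtension) : E.Equivalent (zero E.inducedAction) := by
  obtain ⟨S, h, hincl, hproj, hact⟩ := hE
  have hE : (ofExtension S E.inducedAction).HasMorphism E := by
    refine ⟨E.inclAdd, h, ⟨fun y => ?_, fun x y => ?_⟩, fun a => add_zero _, hproj⟩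
    · change h (S.incl y.2) = E.cm.bdry (E.incl y.1 + y.2)
      rw [map_add, E.exact_incl_bdry.apply_apply_eq_zero, zero_add, hincl]
    · have key (x : S.L) (a : M) (y : E.m) :
          E.incl (E.inducedAction (S.proj x) a) + S.crossedModule.act x y =
            E.cm.act (h x) (E.incl a + y) := by
        have hx : S.crossedModule.act x y = E.cm.act (h x) y :=
          S.incl_injective ((S.incl_crossedModule_act x y).trans (hact x y).symm)
        rw [map_add, ← hproj, E.incl_inducedAction, hx]
      exact key x y.1 y.2
  exact .trans _ _ _ (.symm _ _ (.rel _ _ hE))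
    (.rel _ _ (ofExtension_hasMorphism_zero S E.inducedAction))

end LieCrossedExtension

theorem mainTheorem2 {R : Type u} [CommRing R] {q M : Type v}
    [LieRing q] [LieAlgebra R q] [LieRing M] [LieAlgebra R M] [IsLieAbelian M]
    (E : LieCrossedExtension R q M) :
    E.Equivalent (LieCrossedExtension.zero E.inducedAction) ↔
      ∃ (S : LieAlgebra.Extension.{u, v, v, v} R E.m q) (h : S.L →ₗ⁅R⁆ E.n),
        (∀ y : E.m, h (S.incl y) = E.cm.bdry y) ∧
        (∀ x : S.L, E.proj (h x) = S.proj x) ∧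
        LieCrossedModule.IsHom S.crossedModule E.cm (LieHom.id : E.m →ₗ⁅R⁆ E.m) h := by
  rw [← E.liftsToExtension_iff]
  exact ⟨fun h => h.liftsToExtension_iff.2 (LieCrossedExtension.zero_liftsToExtension _),
    fun h => h.equivalent_zero⟩
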